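/- Let $(X,d)$ be a complete metric space that is doubling (for some $n$, every ball of radius $r>0$ is covered by at most $n$ balls of radius $r/2$), let $\mu$ be a Borel measure on $X$, and let $\{(X_\alpha,\varphi^\alpha)\}_{\alpha\in I}$ be a measurable differentiable structure on $(X,d,\mu)$. That is: $I$ is countable; the $X_\alpha$ are pairwise disjoint measurable sets of positive measure whose union has full measure; each $\varphi^\alpha=(\varphi^\alpha_1,\dots,\varphi^\alpha_{N(\alpha)})$ is a tuple of Lipschitz functions $X\to\mathbb R$, with $\sup_\alpha N(\alpha)<\infty$; and every Lipschitz $f\colon X\to\mathbb R$ is differentiable at almost every point of $X$. Here, for a measurable set $S\subseteq X$ and a Banach space $V$, a map $f\colon X\to V$ is differentiable at almost every point of $S$ with differentials $\partial f/\partial\varphi^\alpha_n\colon S\cap X_\alpha\to V$ if these functions are measurable, if for each $\alpha$ and $\mu$-almost every $x_0\in S\cap X_\alpha$ $$\lim_{\substack{x\to x_0\\ x\in X_\alpha\setminus\{x_0\}}}\frac{\bigl\| f(x)-f(x_0)-\sum_{n=1}^{N(\alpha)}(\varphi^\alpha_n(x)-\varphi^\alpha_n(x_0))\,\frac{\partial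 f}{\partial\varphi^\alpha_n}(x_0)\bigr\|}{d(x,x_0)}=0,\qquad(1)$$ and if this condition determines the differentials uniquely up to $\mu$-null sets. Let $V$ be a real Banach space, $\iota\colon X\to V$ a homeomorphism onto its image, and $C\subseteq X$ a closed set such that, for some $A\ge1$, $A^{-1}d(x,y)\le\|\iota(x)-\iota(y)\|\le A\,d(x,y)$ for all $x,y\in C$. Assume that $\iota$ is differentiable at almost every point of $C$, with differentials $\partial\iota/\partial\varphi^\alpha_n$. For $x_0\in C\cap X_\alpha$ let $F_{x_0}\subseteq V$ be the linear span of $\frac{\partial\iota}{\partial\varphi^\alpha_n}(x_0)$, $1\le n\le N(\alpha)$. A pointed metric space $(T,d_\infty,t_0)$ is a weak tangent to $C$ at $x_0\in C$ if it is the limit of the pointed metric spaces $(C,d/r_j,x_0)$ for some scales $r_j>0$ with $r_j\to0$, in the following sense. There are $N\in\mathbb N$, $\beta\in(0,1]$, $K\ge1$ and maps $f_j\colon C\to\mathbb R^N$, $f\colon T\to\mathbb R^N$ with $f_j(x_0)=0=f(t_0)$ such that - $K^{-1}(d(x,y)/r_j)^\beta\le|f_j(x)-f_j(y)|\le K(d(x,y)/r_j)^\beta$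 for all $x,y\in C$ and all $j$, and $K^{-1}d_\infty(s,t)^\beta\le|f(s)-f(t)|\le K d_\infty(s,t)^\beta$ for all $s,t\in T$; - the sets $F_j=f_j(C)$ and $F=f(T)$ are closed, and for every $r>0$ both $\sup\{\operatorname{dist}(p,F):p\in F_j\cap B(0,r)\}\to0$ and $\sup\{\operatorname{dist}(p,F_j):p\in F\cap B(0,r)\}\to0$ as $j\to\infty$ (with $\sup\emptyset=0$); - whenever $u_j,v_j\in C$ and $s,t\in T$ satisfy $f_j(u_j)\to f(s)$ and $f_j(v_j)\to f(t)$, then $d(u_j,v_j)/r_j\to d_\infty(s,t)$. Then for each $\alpha\in I$: (i) Let $x_0\in C\cap X_\alpha$ be a point at which (1) holds for $f=\iota$, and suppose that $C\cap X_\alpha$ fills out $C$ to first order at $x_0$, that is, $$\lim_{\substack{x\to x_0\\ x\in C\setminus\{x_0\}}}\frac{\operatorname{dist}(x,C\cap X_\alpha)}{d(x,x_0)}=0.\qquad(2)$$ Then every weak tangent to $C$ at $x_0$ admits a bi-Lipschitz embedding into $F_{x_0}$. (ii) If $\mu$ is doubling (balls have positive finite measure, and $\mu(B(x,2r))\le c\,\mu(B(x,r))$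 for a constant $c$ and all $x\in X$, $r>0$), then for $\mu$-almost every $x_0\in C\cap X_\alpha$, every weak tangent to $C$ at $x_0$ admits a bi-Lipschitz embedding into $F_{x_0}$. -/

import Mathlib

open Set Filter Topology MeasureTheory

/-- A metric space is doubling if there is `n` such that every ball of radius `r > 0` is covered
by at most `n` balls of radius `r / 2`. -/
def IsDoublingSpace (X : Type*) [MetricSpace X] : Prop :=
  ∃ n : ℕ, ∀ (x : X) (r : ℝ), 0 < r →
    ∃ s : Finset X, s.card ≤ n ∧ Metric.ball x r ⊆ ⋃ y ∈ s, Metric.ball y (r / 2)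

/-- A metric measure space is doubling if balls have positive and finite measure and
`μ (2B) ≤ c * μ B` for every open ball `B`. -/
def IsDoublingMeasure {X : Type*} [MetricSpace X] [MeasurableSpace X] (μ : Measure X) : Prop :=
  ∃ c : NNReal, 1 ≤ c ∧ ∀ (x : X) (r : ℝ), 0 < r →
    0 < μ (Metric.ball x r) ∧ μ (Metric.ball x r) < ⊤ ∧
      μ (Metric.ball x (2 * r)) ≤ c * μ (Metric.ball x r)

/-- `f` is an `A`-bi-Lipschitz embedding. -/
def IsBiLipschitz {Y Z : Type*} [MetricSpace Y] [MetricSpace Z] (A : ℝ) (f : Y → Z) : Prop :=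
  ∀ y y' : Y, A⁻¹ * dist y y' ≤ dist (f y) (f y') ∧ dist (f y) (f y') ≤ A * dist y y'

/-- `f` is `(β, K)`-bi-Hölder on `Y` equipped with the rescaled metric `dist / r`. -/
def IsBiHolderAtScale {Y Z : Type*} [MetricSpace Y] [MetricSpace Z] (r β K : ℝ) (f : Y → Z) :
    Prop :=
  ∀ y y' : Y, K⁻¹ * (dist y y' / r) ^ β ≤ dist (f y) (f y') ∧
    dist (f y) (f y') ≤ K * (dist y y' / r) ^ β

/-- Convergence of non-empty closed subsets `F j` of `ℝᴺ` to a non-empty closed subset `F∞`.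
The sets whose supremum is taken are bounded above, and `sSup ∅ = 0`. -/
def SetsConverge {N : ℕ} (F : ℕ → Set (EuclideanSpace ℝ (Fin N)))
    (Flim : Set (EuclideanSpace ℝ (Fin N))) : Prop :=
  (∀ j, IsClosed (F j) ∧ (F j).Nonempty) ∧ IsClosed Flim ∧ Flim.Nonempty ∧
  ∀ r : ℝ, 0 < r →
    Tendsto (fun j => sSup ((fun x => Metric.infDist x Flim) '' (F j ∩ Metric.ball 0 r)))
      atTop (𝓝 0) ∧
    Tendsto (fun j => sSup ((fun x => Metric.infDist x (F j)) '' (Flim ∩ Metric.ball 0 r)))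
      atTop (𝓝 0)

/-- The pointed metric spaces `(Y, dist / r j, y₀)` converge to the pointed metric space
`(T, dist, t₀)`: there are base-point preserving maps `f j : Y → ℝᴺ` and `f∞ : T → ℝᴺ`, uniformly
bi-Hölder, whose images converge, and such that the rescaled distances, transported to the images,
converge to the transported distance of `T`. A convergent sequence of points of the images
`f j (Y)` has its limit in `f∞ (T)`, so the last clause ranges over all convergent sequences. -/
def RescalingsConverge {Y : Type*} [MetricSpace Y] (y₀ : Y) (r : ℕ → ℝ)
    {T : Type*} [MetricSpace T] (t₀ : T) : Prop :=
  ∃ (N : ℕ) (β K : ℝ) (f : ℕ → Y → EuclideanSpace ℝ (Fin N))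
    (flim : T → EuclideanSpace ℝ (Fin N)),
    0 < β ∧ β ≤ 1 ∧ 1 ≤ K ∧
    (∀ j, f j y₀ = 0 ∧ IsBiHolderAtScale (r j) β K (f j)) ∧
    (flim t₀ = 0 ∧ IsBiHolderAtScale 1 β K flim) ∧
    SetsConverge (fun j => range (f j)) (range flim) ∧
    ∀ (u v : ℕ → Y) (s t : T),
      Tendsto (fun j => f j (u j)) atTop (𝓝 (flim s)) →
      Tendsto (fun j => f j (v j)) atTop (𝓝 (flim t)) →
      Tendsto (fun j => dist (u j) (v j) / r j) atTop (𝓝 (dist s t))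

/-- The pointed metric space `(T, t₀)` is a weak tangent to `C` at `x₀ ∈ C`. -/
def IsWeakTangent {X : Type*} [MetricSpace X] (C : Set X) (x₀ : C)
    {T : Type*} [MetricSpace T] (t₀ : T) : Prop :=
  ∃ r : ℕ → ℝ, (∀ j, 0 < r j) ∧ Tendsto r atTop (𝓝 0) ∧ RescalingsConverge x₀ r t₀

/-- A family of coordinate patches: sets `X_α` with tuples `φ_α` of real functions on `X`. -/
structure CoordinatePatches (X I : Type*) where
  /-- the set `X_α` -/
  patch : I → Set X
  /-- the dimension `N(α)` -/
  dim : I → ℕ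
  /-- the coordinate functions `φ_n^α` -/
  coord : (α : I) → Fin (dim α) → X → ℝ

namespace CoordinatePatches

variable {X I V : Type*} [MetricSpace X] [NormedAddCommGroup V] [NormedSpace ℝ V]

/-- The first order expansion of `f` at `x`, along `X_α`, with partial derivatives `v n`. -/
def HasPartialsAt (P : CoordinatePatches X I) (α : I) (f : X → V) (v : Fin (P.dim α) → V)
    (x : X) : Prop :=
  Tendsto
    (fun y => ‖f y - f x - ∑ n, (P.coord α n y - P.coord α n x) • v n‖ / dist y x)
    (𝓝[P.patch α \ {x}] x) (𝓝 0)

/-- `D` is a collection of functions, measurable on the sets `S ∩ X_α` (with respect to the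
completion of `μ`), giving the first order expansion of `f` at almost every point of `S`. -/
def HasPartialsOn [MeasurableSpace X] [MeasurableSpace V] (P : CoordinatePatches X I)
    (μ : Measure X) (S : Set X) (f : X → V) (D : (α : I) → Fin (P.dim α) → X → V) : Prop :=
  ∀ α, (∀ n, NullMeasurable (D α n) (μ.restrict (S ∩ P.patch α))) ∧
    ∀ᵐ x ∂μ, x ∈ S ∩ P.patch α → P.HasPartialsAt α f (fun n => D α n x) x

/-- `f` has the differentials `D` at almost every point of `S`, and these are determined by the
first order expansion uniquely up to null sets. -/
def HasUniquePartialsOn [MeasurableSpace X] [MeasurableSpace V] (P : CoordinatePatches X I)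
    (μ : Measure X) (S : Set X) (f : X → V) (D : (α : I) → Fin (P.dim α) → X → V) : Prop :=
  P.HasPartialsOn μ S f D ∧
    ∀ D' : (α : I) → Fin (P.dim α) → X → V, P.HasPartialsOn μ S f D' →
      ∀ α n, ∀ᵐ x ∂μ, x ∈ S ∩ P.patch α → D' α n x = D α n x

/-- The coordinate patches form a measurable differentiable structure on `(X, d, μ)`. -/
structure IsMeasurableDifferentiableStructure [MeasurableSpace X] (P : CoordinatePatches X I)
    (μ : Measure X) : Prop where
  countable : Countable I
  measurable_patch : ∀ α, NullMeasurableSet (P.patch α) μ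
  pos_patch : ∀ α, 0 < μ (P.patch α)
  disjoint : Pairwise fun α β => Disjoint (P.patch α) (P.patch β)
  full : μ (⋃ α, P.patch α)ᶜ = 0
  lipschitz : ∀ α n, ∃ K, LipschitzWith K (P.coord α n)
  dim_bdd : ∃ N, ∀ α, P.dim α ≤ N
  differentiable : ∀ f : X → ℝ, (∃ K, LipschitzWith K f) →
    ∃ D : (α : I) → Fin (P.dim α) → X → ℝ, P.HasUniquePartialsOn μ univ f D

end CoordinatePatches

/-!
At a point `x₀` where `ι` is differentiable, `ι y - ι x₀` agrees for `y ∈ X_α` with an element of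
`F_{x₀}`, the span of the partial derivatives, up to an error `o(dist y x₀)`. A point `t` of a weak
tangent is approximated by points of `C` at distance comparable to `r j` from `x₀`, and when
`C ∩ X_α` fills out `C` to first order these can be moved into `C ∩ X_α` at a cost `o(r j)`
(`RescalingsConverge.exists_approximating_sequences`). The linear approximations of `ι` at these
points, divided by `r j`, are bounded in the finite-dimensional space `F_{x₀}`, so they converge
along an ultrafilter; their limits define a map `G` on the tangent. Since the differences of the
approximations are those of `ι`, up to `o(r j)`, and `ι` is `A`-bi-Lipschitz on `C`, so is `G`
(`exists_isBiLipschitz_of_isWeakTangent`).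

For a doubling measure, almost every point of `C ∩ X_α` is a density point of `C ∩ X_α`, even along
balls that are not centred at the point. If `infDist y (C ∩ X_α) ≥ ε * dist y x₀` for points `y`
arbitrarily near `x₀`, the balls centred at `y` of radius `ε / 2 * dist y x₀` would miss
`C ∩ X_α`, against density; so the first order condition holds almost everywhere
(`IsDoublingMeasure.ae_tendsto_infDist_div`).
-/

/-! ### Approximation of weak tangents -/

/-- Every point of the limit set is the limit of points of the converging sets. Since all
the sets contain the origin, the suprema in `SetsConverge` are over bounded sets, not junk. -/
lemma SetsConverge.exists_tendsto {N : ℕ} {F : ℕ → Set (EuclideanSpace ℝ (Fin N))}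
    {Flim : Set (EuclideanSpace ℝ (Fin N))} (h : SetsConverge F Flim)
    (h0 : ∀ j, (0 : EuclideanSpace ℝ (Fin N)) ∈ F j)
    {p : EuclideanSpace ℝ (Fin N)} (hp : p ∈ Flim) :
    ∃ q : ℕ → EuclideanSpace ℝ (Fin N), (∀ j, q j ∈ F j) ∧ Tendsto q atTop (𝓝 p) := by
  obtain ⟨-, -, -, h⟩ := h
  have hr : 0 < ‖p‖ + 1 := by positivity
  have hlim := (h _ hr).2
  have hle : ∀ j, Metric.infDist p (F j) ≤
      sSup ((fun x => Metric.infDist x (F j)) '' (Flim ∩ Metric.ball 0 (‖p‖ + 1))) := by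
    intro j
    refine le_csSup ⟨‖p‖ + 1, ?_⟩ (mem_image_of_mem _ ⟨hp, by simp⟩)
    rintro _ ⟨x, ⟨-, hx⟩, rfl⟩
    exact (Metric.infDist_le_dist_of_mem (h0 j)).trans (Metric.mem_ball.1 hx).le
  have hex : ∀ j : ℕ, ∃ q ∈ F j, dist p q < Metric.infDist p (F j) + 1 / ((j : ℝ) + 1) := fun j =>
    (Metric.infDist_lt_iff ⟨0, h0 j⟩).1 (lt_add_of_pos_right _ (by positivity))
  choose q hqF hq using hex
  refine ⟨q, hqF, tendsto_iff_dist_tendsto_zero.2 ?_⟩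
  have hsum := hlim.add (tendsto_one_div_add_atTop_nhds_zero_nat (𝕜 := ℝ))
  rw [add_zero] at hsum
  refine squeeze_zero (fun _ => dist_nonneg) (fun j => ?_) hsum
  rw [dist_comm]
  exact (hq j).le.trans (add_le_add_left (hle j) _)

/-- Points of a limit of rescalings of `Y` are approximated, as far as distances are concerned, by
points of any set `S` that fills out `Y` to first order at the base point. -/
lemma RescalingsConverge.exists_approximating_sequences {Y : Type*} [MetricSpace Y] {y₀ : Y}
    {r : ℕ → ℝ} (hr : ∀ j, 0 < r j) (hr0 : Tendsto r atTop (𝓝 0))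
    {T : Type*} [MetricSpace T] {t₀ : T} (h : RescalingsConverge y₀ r t₀)
    {S : Set Y} (hy₀ : y₀ ∈ S)
    (hS : Tendsto (fun y => Metric.infDist y S / dist y y₀) (𝓝[≠] y₀) (𝓝 0)) :
    ∃ w : T → ℕ → Y, (∀ t j, w t j ∈ S) ∧
      (∀ t, Tendsto (fun j => dist (w t j) y₀ / r j) atTop (𝓝 (dist t t₀))) ∧
      ∀ s t, Tendsto (fun j => dist (w s j) (w t j) / r j) atTop (𝓝 (dist s t)) := by
  obtain ⟨N, β, K, f, flim, -, -, -, hf, ⟨hflim, -⟩, hsets, hdist⟩ := h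
  have hu : ∀ t : T, ∃ u : ℕ → Y, Tendsto (fun j => f j (u j)) atTop (𝓝 (flim t)) := by
    intro t
    obtain ⟨q, hq, hqt⟩ := hsets.exists_tendsto (fun j => ⟨y₀, (hf j).1⟩) (mem_range_self t)
    choose u hu using hq
    exact ⟨u, by simpa only [hu] using hqt⟩
  choose u hu using hu
  have hu₀ : ∀ t, Tendsto (fun j => dist (u t j) y₀ / r j) atTop (𝓝 (dist t t₀)) := fun t =>
    hdist (u t) (fun _ => y₀) t t₀ (hu t) (by simp only [(hf _).1, hflim, tendsto_const_nhds])
  have huy : ∀ t, Tendsto (u t) atTop (𝓝 y₀) := by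
    intro t
    refine tendsto_iff_dist_tendsto_zero.2 ?_
    have := (hu₀ t).mul hr0
    rw [mul_zero] at this
    exact this.congr fun j => div_mul_cancel₀ _ (hr j).ne'
  -- The quotient takes the value `0 / 0 = 0` at `y₀`, so it is continuous there.
  have hS' : Tendsto (fun y => Metric.infDist y S / dist y y₀) (𝓝 y₀) (𝓝 0) := by
    have : ContinuousAt (fun y => Metric.infDist y S / dist y y₀) y₀ :=
      continuousAt_iff_punctured_nhds.2 (by simpa using hS)
    simpa [ContinuousAt] using this
  have hinf : ∀ t, Tendsto (fun j => Metric.infDist (u t j) S / r j) atTop (𝓝 0) := by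
    intro t
    have := (hS'.comp (huy t)).mul (hu₀ t)
    rw [zero_mul] at this
    refine this.congr fun j => ?_
    rcases eq_or_ne (u t j) y₀ with h | h
    · simp [h, Metric.infDist_zero_of_mem hy₀]
    · exact div_mul_div_cancel₀ (dist_ne_zero.2 h)
  have hex : ∀ (t : T) (j : ℕ), ∃ w ∈ S,
      dist (u t j) w < Metric.infDist (u t j) S + r j * (1 / ((j : ℝ) + 1)) := fun t j =>
    (Metric.infDist_lt_iff ⟨y₀, hy₀⟩).1
      (lt_add_of_pos_right _ (mul_pos (hr j) (by positivity)))
  choose w hwS hw using hex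
  have hwu : ∀ t, Tendsto (fun j => dist (u t j) (w t j) / r j) atTop (𝓝 0) := by
    intro t
    have hsum := (hinf t).add (tendsto_one_div_add_atTop_nhds_zero_nat (𝕜 := ℝ))
    rw [add_zero] at hsum
    refine squeeze_zero (fun j => div_nonneg dist_nonneg (hr j).le) (fun j => ?_) hsum
    rw [div_le_iff₀ (hr j), add_mul, div_mul_cancel₀ _ (hr j).ne', mul_comm _ (r j)]
    exact (hw t j).le
  -- Moving both points by `o(r j)` does not change the limit of the rescaled distances.
  have key : ∀ (a b a' b' : ℕ → Y) (l : ℝ),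
      Tendsto (fun j => dist (a j) (a' j) / r j) atTop (𝓝 0) →
      Tendsto (fun j => dist (b j) (b' j) / r j) atTop (𝓝 0) →
      Tendsto (fun j => dist (a j) (b j) / r j) atTop (𝓝 l) →
      Tendsto (fun j => dist (a' j) (b' j) / r j) atTop (𝓝 l) := by
    intro a b a' b' l ha hb hab
    refine tendsto_of_tendsto_of_dist hab ?_
    have hsum := ha.add hb
    rw [add_zero] at hsum
    refine squeeze_zero (fun _ => dist_nonneg) (fun j => ?_) hsum
    rw [Real.dist_eq, ← sub_div, ← add_div, abs_div, abs_of_pos (hr j)]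
    exact div_le_div_of_nonneg_right (by
      simpa only [Real.dist_eq] using dist_dist_dist_le (a j) (b j) (a' j) (b' j)) (hr j).le
  refine ⟨w, hwS, fun t => ?_, fun s t => ?_⟩
  · exact key (u t) (fun _ => y₀) (w t) (fun _ => y₀) _ (hwu t) (by simp) (hu₀ t)
  · exact key (u s) (u t) (w s) (w t) _ (hwu s) (hwu t) (hdist _ _ s t (hu s) (hu t))

/-! ### Embedding a weak tangent into the span of the partial derivatives -/

/-- The embedding is the ultralimit of the rescaled linear approximations of `ι` along sequences
representing the points of the tangent. -/
lemma exists_isBiLipschitz_of_isWeakTangent {X I V : Type*} [MetricSpace X]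
    [NormedAddCommGroup V] [NormedSpace ℝ V] (P : CoordinatePatches X I) (α : I)
    {ι : X → V} {C : Set X} {A : ℝ} (hιC : IsBiLipschitz A (fun x : C => ι x))
    {v : Fin (P.dim α) → V} {x₀ : X} (hx₀ : x₀ ∈ C) (hx₀α : x₀ ∈ P.patch α)
    (hv : P.HasPartialsAt α ι v x₀)
    (hfill : Tendsto (fun x => Metric.infDist x (C ∩ P.patch α) / dist x x₀)
      (𝓝[C \ {x₀}] x₀) (𝓝 0))
    {T : Type*} [MetricSpace T] {t₀ : T} (hT : IsWeakTangent C ⟨x₀, hx₀⟩ t₀) :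
    ∃ G : T → Submodule.span ℝ (range v), IsBiLipschitz A G := by
  obtain ⟨r, hr, hr0, hconv⟩ := hT
  obtain ⟨w, hwS, hw₀, hw⟩ := hconv.exists_approximating_sequences hr hr0
    (S := Subtype.val ⁻¹' P.patch α) hx₀α (by
      have hcoe : Tendsto (Subtype.val : C → X) (𝓝[≠] ⟨x₀, hx₀⟩) (𝓝[C \ {x₀}] x₀) := by
        refine tendsto_nhdsWithin_iff.2
          ⟨(continuous_subtype_val.tendsto _).mono_left nhdsWithin_le_nhds, ?_⟩
        filter_upwards [self_mem_nhdsWithin] with y hy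
        exact ⟨y.2, fun h => hy (Subtype.ext h)⟩
      refine (hfill.comp hcoe).congr fun y => ?_
      simp only [Function.comp_apply, Subtype.dist_eq]
      rw [← Subtype.image_preimage_coe, Metric.infDist_image isometry_subtype_coe])
  let F := Submodule.span ℝ (range v)
  have : FiniteDimensional ℝ F := FiniteDimensional.span_of_finite ℝ (finite_range v)
  let L : T → ℕ → F := fun t j => (r j)⁻¹ •
    ∑ n, (P.coord α n (w t j) - P.coord α n x₀) • ⟨v n, Submodule.subset_span (mem_range_self n)⟩
  -- The first order expansion also holds at `x₀` itself, by the convention `0 / 0 = 0`.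
  have hv' : Tendsto
      (fun y => ‖ι y - ι x₀ - ∑ n, (P.coord α n y - P.coord α n x₀) • v n‖ / dist y x₀)
      (𝓝[P.patch α] x₀) (𝓝 0) := by
    have : ContinuousWithinAt
        (fun y => ‖ι y - ι x₀ - ∑ n, (P.coord α n y - P.coord α n x₀) • v n‖ / dist y x₀)
        (P.patch α) x₀ := by
      refine continuousWithinAt_sdiff_self.1 ?_
      simpa [ContinuousWithinAt, CoordinatePatches.HasPartialsAt] using hv
    simpa [ContinuousWithinAt] using this
  have hL : ∀ t, Tendsto (fun j => (r j)⁻¹ • (ι (w t j) - ι x₀) - (L t j : V)) atTop (𝓝 0) := by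
    intro t
    have hwx : Tendsto (fun j => (w t j : X)) atTop (𝓝[P.patch α] x₀) := by
      refine tendsto_nhdsWithin_iff.2 ⟨tendsto_iff_dist_tendsto_zero.2 ?_,
        Eventually.of_forall (hwS t)⟩
      have := (hw₀ t).mul hr0
      rw [mul_zero] at this
      exact this.congr fun j => div_mul_cancel₀ _ (hr j).ne'
    have hprod := (hv'.comp hwx).mul (hw₀ t)
    rw [zero_mul] at hprod
    refine tendsto_zero_iff_norm_tendsto_zero.2 (hprod.congr fun j => ?_)
    have hLj : (L t j : V) =
        (r j)⁻¹ • ∑ n, (P.coord α n (w t j) - P.coord α n x₀) • v n := by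
      simp [L]
    rw [hLj, ← smul_sub, norm_smul, norm_inv, Real.norm_of_nonneg (hr j).le, inv_mul_eq_div]
    simp only [Function.comp_apply, Subtype.dist_eq]
    rcases eq_or_ne (w t j : X) x₀ with h | h
    · simp [h]
    · exact div_mul_div_cancel₀ (dist_ne_zero.2 h)
  have hι : ∀ (y z : C) (j : ℕ), ‖(r j)⁻¹ • (ι y - ι z)‖ = dist (ι y) (ι z) / r j := by
    intro y z j
    rw [norm_smul, norm_inv, Real.norm_of_nonneg (hr j).le, inv_mul_eq_div, dist_eq_norm]
  have hbdd : ∀ t, ∀ᶠ j in atTop, L t j ∈ Metric.closedBall 0 (|A| * (dist t t₀ + 1) + 1) := by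
    intro t
    filter_upwards [(hw₀ t).eventually_lt_const (lt_add_one _),
      (hL t).norm.eventually_lt_const (by simp : ‖(0 : V)‖ < 1)] with j hj₁ hj₂
    rw [mem_closedBall_zero_iff, Submodule.coe_norm]
    have h₁ : ‖(r j)⁻¹ • (ι (w t j) - ι x₀)‖ ≤ |A| * (dist t t₀ + 1) := by
      rw [hι (w t j) ⟨x₀, hx₀⟩ j]
      calc dist (ι (w t j)) (ι x₀) / r j
          ≤ A * dist (w t j) ⟨x₀, hx₀⟩ / r j :=
            div_le_div_of_nonneg_right (hιC (w t j) ⟨x₀, hx₀⟩).2 (hr j).le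
        _ ≤ |A| * (dist (w t j) ⟨x₀, hx₀⟩ / r j) := by
            rw [mul_div_assoc]
            exact mul_le_mul_of_nonneg_right (le_abs_self A) (div_nonneg dist_nonneg (hr j).le)
        _ ≤ |A| * (dist t t₀ + 1) := mul_le_mul_of_nonneg_left hj₁.le (abs_nonneg A)
    have h₂ := norm_sub_norm_le (L t j : V) ((r j)⁻¹ • (ι (w t j) - ι x₀))
    rw [norm_sub_rev] at h₂
    linarith
  -- An ultrafilter replaces the choice of a subsequence common to all points of `T`.
  have hG : ∀ t, ∃ g : F, Tendsto (L t) (hyperfilter ℕ) (𝓝 g) := by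
    intro t
    obtain ⟨g, -, hg⟩ :=
      (isCompact_closedBall (0 : F) (|A| * (dist t t₀ + 1) + 1)).ultrafilter_le_nhds
      ((hyperfilter ℕ).map (L t)) (by
        rw [le_principal_iff]
        exact Nat.hyperfilter_le_atTop (hbdd t))
    exact ⟨g, hg⟩
  choose G hG using hG
  refine ⟨G, fun s t => ?_⟩
  have hlim : Tendsto (fun j => dist (ι (w s j)) (ι (w t j)) / r j) (hyperfilter ℕ)
      (𝓝 (dist (G s) (G t))) := by
    have hsub := ((hL s).sub (hL t)).mono_left Nat.hyperfilter_le_atTop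
    have hsum := hsub.add ((continuous_subtype_val.tendsto _).comp ((hG s).sub (hG t)))
    rw [sub_zero, zero_add] at hsum
    rw [dist_eq_norm, Submodule.coe_norm]
    refine hsum.norm.congr fun j => ?_
    rw [← hι]
    congr 1
    simp only [Function.comp_apply, Submodule.coe_sub, smul_sub]
    abel
  have hst := (hw s t).mono_left Nat.hyperfilter_le_atTop
  constructor
  · refine le_of_tendsto_of_tendsto' (hst.const_mul A⁻¹) hlim fun j => ?_
    rw [← mul_div_assoc]
    exact div_le_div_of_nonneg_right (hιC (w s j) (w t j)).1 (hr j).le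
  · refine le_of_tendsto_of_tendsto' hlim (hst.const_mul A) fun j => ?_
    rw [← mul_div_assoc]
    exact div_le_div_of_nonneg_right (hιC (w s j) (w t j)).2 (hr j).le

/-! ### Density points for doubling measures -/

lemma IsDoublingSpace.totallyBounded_ball {X : Type*} [MetricSpace X] (hX : IsDoublingSpace X)
    (x : X) {r : ℝ} (hr : 0 < r) : TotallyBounded (Metric.ball x r) := by
  obtain ⟨n, hn⟩ := hX
  have hcover : ∀ k : ℕ, ∃ s : Set X, s.Finite ∧
      Metric.ball x r ⊆ ⋃ y ∈ s, Metric.ball y (r / 2 ^ k) := by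
    intro k
    induction k with
    | zero => exact ⟨{x}, finite_singleton x, by simp⟩
    | succ k ih =>
      obtain ⟨s, hs, hsub⟩ := ih
      choose F _ hF using fun y => hn y (r / 2 ^ k) (by positivity)
      refine ⟨⋃ y ∈ s, F y, hs.biUnion fun y _ => (F y).finite_toSet, fun z hz => ?_⟩
      obtain ⟨y, hy, hzy⟩ := mem_iUnion₂.1 (hsub hz)
      obtain ⟨a, ha, hza⟩ := mem_iUnion₂.1 (hF y hzy)
      refine mem_iUnion₂.2 ⟨a, mem_iUnion₂.2 ⟨y, hy, ha⟩, ?_⟩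
      rwa [div_div, ← pow_succ] at hza
  refine Metric.totallyBounded_iff.2 fun ε hε => ?_
  obtain ⟨k, hk⟩ := exists_pow_lt_of_lt_one (div_pos hε hr) (one_half_lt_one (α := ℝ))
  obtain ⟨s, hs, hsub⟩ := hcover k
  refine ⟨s, hs, hsub.trans (iUnion₂_mono fun y _ => Metric.ball_subset_ball ?_)⟩
  rw [lt_div_iff₀ hr, one_div, inv_pow] at hk
  rw [div_eq_inv_mul]
  exact hk.le

lemma IsDoublingSpace.secondCountableTopology {X : Type*} [MetricSpace X]
    (hX : IsDoublingSpace X) : SecondCountableTopology X := by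
  have hsep : TopologicalSpace.IsSeparable (univ : Set X) := by
    rcases isEmpty_or_nonempty X with h | ⟨⟨x⟩⟩
    · exact (finite_univ (α := X)).isSeparable
    rw [← Metric.iUnion_ball_nat_succ x]
    exact .iUnion fun n => (hX.totallyBounded_ball x n.cast_add_one_pos).isSeparable
  have := TopologicalSpace.isSeparable_univ_iff.1 hsep
  exact UniformSpace.secondCountable_of_separable X

lemma IsDoublingMeasure.isLocallyFiniteMeasure {X : Type*} [MetricSpace X] [MeasurableSpace X]
    {μ : Measure X} (hμ : IsDoublingMeasure μ) : IsLocallyFiniteMeasure μ := by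
  obtain ⟨c, -, h⟩ := hμ
  exact ⟨fun x => ⟨_, Metric.ball_mem_nhds x one_pos, (h x 1 one_pos).2.1⟩⟩

/-- Doubling for open balls, used twice, gives it for closed ones. -/
lemma IsDoublingMeasure.isUnifLocDoublingMeasure {X : Type*} [MetricSpace X] [MeasurableSpace X]
    {μ : Measure X} (hμ : IsDoublingMeasure μ) : IsUnifLocDoublingMeasure μ := by
  obtain ⟨c, -, h⟩ := hμ
  refine ⟨c * c, ?_⟩
  filter_upwards [self_mem_nhdsWithin] with ε hε x
  have hε : 0 < ε := hε
  calc μ (Metric.closedBall x (2 * ε))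
      ≤ μ (Metric.ball x (2 * (2 * ε))) :=
        measure_mono (Metric.closedBall_subset_ball (by linarith))
    _ ≤ c * μ (Metric.ball x (2 * ε)) := (h x _ (by positivity)).2.2
    _ ≤ c * (c * μ (Metric.ball x ε)) := by gcongr; exact (h x ε hε).2.2
    _ ≤ (c * c : NNReal) * μ (Metric.closedBall x ε) := by
        rw [ENNReal.coe_mul, mul_assoc]
        gcongr
        exact Metric.ball_subset_closedBall

/-- For a doubling measure, every set `S` fills out the whole space to first order at almost all of
its points. -/
lemma IsDoublingMeasure.ae_tendsto_infDist_div {X : Type*} [MetricSpace X]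
    [SecondCountableTopology X] [MeasurableSpace X] [BorelSpace X] {μ : Measure X}
    (hμ : IsDoublingMeasure μ) {S : Set X} (hS : NullMeasurableSet S μ) :
    ∀ᵐ x ∂μ, x ∈ S →
      Tendsto (fun y => Metric.infDist y S / dist y x) (𝓝[≠] x) (𝓝 0) := by
  have := hμ.isLocallyFiniteMeasure
  have := hμ.isUnifLocDoublingMeasure
  have hdens := ae_all_iff.2 fun n : ℕ =>
    IsUnifLocDoublingMeasure.ae_tendsto_measure_inter_div μ S (n : ℝ)
  rw [ae_restrict_iff'₀ hS] at hdens
  filter_upwards [hdens] with x hx hxS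
  refine tendsto_order.2 ⟨fun a ha => Eventually.of_forall fun y =>
    ha.trans_le (div_nonneg Metric.infDist_nonneg dist_nonneg), fun ε hε => ?_⟩
  by_contra hfreq
  -- Along the filter `l` of the bad points near `x`, the balls `B(y, ε / 2 * dist y x)` miss `S`.
  let l := 𝓝[≠] x ⊓ 𝓟 {y | ¬ Metric.infDist y S / dist y x < ε}
  have hl : l.NeBot := frequently_mem_iff_neBot.1 (not_eventually.1 hfreq)
  have hlx : Tendsto id l (𝓝 x) := (inf_le_left.trans nhdsWithin_le_nhds : l ≤ 𝓝 x)
  have hne : ∀ᶠ y in l, y ≠ x := (inf_le_left : l ≤ 𝓝[≠] x) self_mem_nhdsWithin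
  have hbad : ∀ᶠ y in l, ¬ Metric.infDist y S / dist y x < ε :=
    (inf_le_right : l ≤ _) (mem_principal_self _)
  obtain ⟨n, hn⟩ := exists_nat_gt (2 / ε)
  have hlim := hx hxS n (l := l) id (fun y => ε / 2 * dist y x) (by
      refine tendsto_nhdsWithin_iff.2 ⟨?_, ?_⟩
      · have := ((tendsto_iff_dist_tendsto_zero.1 hlx).const_mul (ε / 2))
        simpa using this
      · filter_upwards [hne] with y hy
        exact mul_pos (half_pos hε) (dist_pos.2 hy)) (by
      filter_upwards with y
      rw [Metric.mem_closedBall, dist_comm, id, ← mul_assoc]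
      refine le_mul_of_one_le_left dist_nonneg ?_
      rw [div_lt_iff₀ hε] at hn
      linarith)
  have hzero : ∀ᶠ y in l, μ (S ∩ Metric.closedBall (id y) (ε / 2 * dist y x)) /
      μ (Metric.closedBall (id y) (ε / 2 * dist y x)) = 0 := by
    filter_upwards [hne, hbad] with y hy hbad
    have hpos := dist_pos.2 hy
    have hempty : S ∩ Metric.closedBall y (ε / 2 * dist y x) = ∅ := by
      refine eq_empty_of_forall_notMem fun z ⟨hzS, hz⟩ => hbad ?_
      rw [Metric.mem_closedBall, dist_comm] at hz
      rw [div_lt_iff₀ hpos]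
      have := Metric.infDist_le_dist_of_mem (x := y) hzS
      nlinarith [mul_pos hε hpos]
    simp [hempty]
  exact zero_ne_one (tendsto_nhds_unique (tendsto_const_nhds.congr' (hzero.mono fun _ h => h.symm))
    hlim)

theorem mainTheorem8
    {X : Type*} [MetricSpace X] [CompleteSpace X] (hX : IsDoublingSpace X)
    [MeasurableSpace X] [BorelSpace X] (μ : Measure X)
    {I : Type*} (P : CoordinatePatches X I) (hP : P.IsMeasurableDifferentiableStructure μ)
    {V : Type*} [NormedAddCommGroup V] [NormedSpace ℝ V] [CompleteSpace V]
    [MeasurableSpace V] [BorelSpace V]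
    (ι : X → V) (hι : IsEmbedding ι)
    (C : Set X) (hC : IsClosed C)
    (A : ℝ) (hA : 1 ≤ A) (hιC : IsBiLipschitz A (fun x : C => ι x))
    (D : (α : I) → Fin (P.dim α) → X → V) (hD : P.HasUniquePartialsOn μ C ι D) (α : I) :
    -- at a point of differentiability near which `C ∩ X_α` fills out `C` to first order
    (∀ (x₀ : X) (hx₀ : x₀ ∈ C), x₀ ∈ P.patch α →
      P.HasPartialsAt α ι (fun n => D α n x₀) x₀ →
      Tendsto (fun x => Metric.infDist x (C ∩ P.patch α) / dist x x₀)
        (𝓝[C \ {x₀}] x₀) (𝓝 0) →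
      ∀ (T : Type*) [MetricSpace T] (t₀ : T), IsWeakTangent C ⟨x₀, hx₀⟩ t₀ →
        ∃ (K : ℝ) (G : T → Submodule.span ℝ (range fun n => D α n x₀)),
          1 ≤ K ∧ IsBiLipschitz K G) ∧
    -- for a doubling measure, at almost every point
    (IsDoublingMeasure μ →
      ∀ᵐ x₀ ∂μ, ∀ (hx₀ : x₀ ∈ C), x₀ ∈ P.patch α →
        ∀ (T : Type*) [MetricSpace T] (t₀ : T), IsWeakTangent C ⟨x₀, hx₀⟩ t₀ →
          ∃ (K : ℝ) (G : T → Submodule.span ℝ (range fun n => D α n x₀)),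
            1 ≤ K ∧ IsBiLipschitz K G) := by
  refine ⟨fun x₀ hx₀ hx₀α hv hfill T _ t₀ hT => ?_, fun hμ => ?_⟩
  · obtain ⟨G, hG⟩ := exists_isBiLipschitz_of_isWeakTangent P α hιC hx₀ hx₀α hv hfill hT
    exact ⟨A, G, hA, hG⟩
  · have := hX.secondCountableTopology
    filter_upwards [(hD.1 α).2, hμ.ae_tendsto_infDist_div
      (hC.measurableSet.nullMeasurableSet.inter (hP.measurable_patch α))]
      with x₀ hv hfill hx₀ hx₀α T _ t₀ hT
    obtain ⟨G, hG⟩ := exists_isBiLipschitz_of_isWeakTangent P α hιC hx₀ hx₀α (hv ⟨hx₀, hx₀α⟩)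
      ((hfill ⟨hx₀, hx₀α⟩).mono_left (nhdsWithin_mono _ fun y hy => hy.2)) hT
    exact ⟨A, G, hA, hG⟩
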